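/- Theorem 1.6. Let $p,q,r,s$ be prime numbers, all congruent to $3$ modulo $4$, such that $$\left(\frac{2}{r}\right)=\left(\frac{2}{s}\right)\neq\left(\frac{2}{q}\right),\qquad \left(\frac{q}{r}\right)=\left(\frac{r}{s}\right)=\left(\frac{s}{q}\right),\qquad \left(\frac{pr}{s}\right)=\left(\frac{ps}{r}\right)=-1,$$ where $\left(\frac{\cdot}{\cdot}\right)$ is the Legendre symbol. Then the bi-quadratic field $K=\mathbb{Q}(\sqrt{2p},\sqrt{2qrs})$ is a Pólya field; that is, for every prime number $\ell$ and every integer $f\ge 1$, the product of all maximal ideals of the ring of integers $\mathcal{O}_K$ of norm $\ell^f$ (the unit ideal if there are none) is a principal ideal. -/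

import Mathlib

open scoped NumberField

/-- The Ostrowski ideal of the number field `K` at `n`: the product of all maximal ideals of `𝓞 K`
whose (absolute) norm is `n`; it is the unit ideal if there are none. -/
noncomputable def ostrowskiIdeal (K : Type*) [Field K] [NumberField K] (n : ℕ) : Ideal (𝓞 K) :=
  ∏ᶠ 𝔪 ∈ {I : Ideal (𝓞 K) | I.IsMaximal ∧ Ideal.absNorm I = n}, 𝔪

/-- The product defining `ostrowskiIdeal K n` is a finite product. -/
theorem finite_maximal_of_absNorm_eq (K : Type*) [Field K] [NumberField K] (n : ℕ) :
    {I : Ideal (𝓞 K) | I.IsMaximal ∧ Ideal.absNorm I = n}.Finite :=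
  (Ideal.finite_setOfPred_absNorm_eq n).subset fun _ h => h.2

/-- A number field `K` is a Pólya field if for every prime power `ℓ ^ f` the product of all
maximal ideals of `𝓞 K` of norm `ℓ ^ f` is a principal ideal. -/
def IsPolyaField (K : Type*) [Field K] [NumberField K] : Prop :=
  ∀ ℓ f : ℕ, ℓ.Prime → 0 < f → (ostrowskiIdeal K (ℓ ^ f)).IsPrincipal

/-- The field `ℚ(√m, √n)`, as a subfield of `ℝ`. -/
noncomputable def adjoinTwoSqrt (m n : ℕ) : IntermediateField ℚ ℝ :=
  IntermediateField.adjoin ℚ {√(m : ℝ), √(n : ℝ)}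

instance adjoinTwoSqrt.instNumberField (m n : ℕ) : NumberField (adjoinTwoSqrt m n) where
  to_charZero := inferInstance
  to_finiteDimensional := by
    have h : ∀ k : ℕ, IsIntegral ℚ (√(k : ℝ)) := fun k => by
      refine IsIntegral.of_pow (n := 2) two_pos ?_
      rw [Real.sq_sqrt (Nat.cast_nonneg k)]
      exact map_natCast (algebraMap ℚ ℝ) k ▸ isIntegral_algebraMap
    unfold adjoinTwoSqrt
    refine IntermediateField.finiteDimensional_adjoin ?_
    rintro x (rfl | rfl)
    exacts [h m, h n]

/-! `K` is Galois over ℚ, so all primes above `ℓ` share one norm and one ramification index `e`.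
Hence an Ostrowski ideal at `ℓ` is trivial or has `e`-th power `(ℓ)`. Inertia above any `ℓ` fixes
the square root of a nonsquare integer, and the group has order at most 4, so `e ≤ 2`. If `e = 2`,
it is enough that `ℓ` is a square up to units in `K`, and only `2, p, q, r, s` can ramify.

Such squares come from Pell's equation. For suitable `N`, the fundamental solution yields `d * e =
N` with `d ≠ 1` and `d a² - e b² = 1` (`exists_factorization_of_pell`), and then `(d a + b√N)²` is
`d` times a unit (`IsSqModUnits.of_pell`). Legendre symbols restrict `d`: it is `2` or `p` for `N =
2p`, `pq` for `N = pqrs`, and `2r` or `2s` for `N = 2qrs`. As `2p` and `2qrs` are squares in `K`,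
division isolates all five primes (`isSqModUnits_primes`). -/

open Ideal in
theorem ostrowskiIdeal_eq_one_or_pow_eq_span (K : Type*) [Field K] [NumberField K] [IsGalois ℚ K]
    {ℓ f : ℕ} (hℓ : ℓ.Prime) :
    ostrowskiIdeal K (ℓ ^ f) = 1 ∨
      ostrowskiIdeal K (ℓ ^ f) ^ (span {(ℓ : ℤ)}).ramificationIdxIn (𝓞 K) =
        span {(ℓ : 𝓞 K)} := by
  have hℓ' : Prime (ℓ : ℤ) := Nat.prime_iff_prime_int.mp hℓ
  have hspan : span {(ℓ : ℤ)} ≠ ⊥ := by simpa using hℓ.ne_zero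
  have : (span {(ℓ : ℤ)}).IsMaximal :=
    ((span_singleton_prime hℓ'.ne_zero).mpr hℓ').isMaximal hspan
  set p : Ideal ℤ := span {(ℓ : ℤ)} with hp
  have hlies {P : Ideal (𝓞 K)} (hP : P.IsMaximal) (hn : absNorm P = ℓ ^ f) : P.LiesOver p := by
    refine ⟨this.eq_of_le (Ideal.IsPrime.under ℤ P).ne_top ?_⟩
    rw [hp, span_singleton_le_iff_mem, mem_comap]
    have : ((ℓ : 𝓞 K)) ^ f ∈ P := by
      have := absNorm_mem P
      rwa [hn, Nat.cast_pow] at this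
    simpa using hP.isPrime.mem_of_pow_mem f this
  have hnorm {P : Ideal (𝓞 K)} (hP : P ∈ p.primesOver (𝓞 K)) :
      absNorm P = ℓ ^ p.inertiaDegIn (𝓞 K) := by
    have := hP.1
    have := hP.2
    rw [inertiaDegIn_eq_inertiaDeg p P Gal(K/ℚ), Ideal.pow_inertiaDeg]
  by_cases hfd : f = p.inertiaDegIn (𝓞 K)
  · right
    have hset : {I : Ideal (𝓞 K) | I.IsMaximal ∧ absNorm I = ℓ ^ f} = p.primesOver (𝓞 K) := by
      ext P
      constructor
      · rintro ⟨h1, h2⟩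
        exact ⟨h1.isPrime, hlies h1 h2⟩
      · intro h
        have := h.1
        have := h.2
        exact ⟨IsMaximal.of_liesOver_isMaximal P p, by rw [hnorm h, hfd]⟩
    have hfin : (p.primesOver (𝓞 K)).Finite := by
      rw [← hset]; exact finite_maximal_of_absNorm_eq K _
    rw [ostrowskiIdeal, hset]
    have hmap := Ideal.map_algebraMap_eq_finsetProd_pow (R := 𝓞 K) (p := p) hspan
    have hspan' : map (algebraMap ℤ (𝓞 K)) p = span {(ℓ : 𝓞 K)} := by
      rw [hp, map_span, Set.image_singleton]
      simp
    rw [← hspan', hmap, finprod_mem_eq_finite_toFinset_prod _ hfin, ← Finset.prod_pow]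
    refine Finset.prod_congr (by ext; simp) fun P hP => ?_
    have hP' : P ∈ p.primesOver (𝓞 K) := by simpa using hP
    have := hP'.1
    have := hP'.2
    rw [ramificationIdxIn_eq_ramificationIdx p P Gal(K/ℚ)]
  · left
    have hset : {I : Ideal (𝓞 K) | I.IsMaximal ∧ absNorm I = ℓ ^ f} = ∅ := by
      refine Set.eq_empty_of_forall_notMem fun P ⟨h1, h2⟩ => hfd ?_
      have h := hnorm ⟨h1.isPrime, hlies h1 h2⟩
      rw [h2] at h
      exact Nat.pow_right_injective hℓ.two_le h
    rw [ostrowskiIdeal, hset, finprod_mem_empty]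

open Ideal in
/-- Some prime of a Galois number field above `ℓ` has an inertia group with `ramificationIdxIn`
elements. -/
theorem exists_card_inertia_eq (K : Type*) [Field K] [NumberField K] [IsGalois ℚ K]
    {ℓ : ℕ} (hℓ : ℓ.Prime) :
    ∃ P : Ideal (𝓞 K), (∀ n : ℤ, (n : 𝓞 K) ∈ P ↔ (ℓ : ℤ) ∣ n) ∧
      Nat.card (P.inertia Gal(K/ℚ)) = (span {(ℓ : ℤ)}).ramificationIdxIn (𝓞 K) := by
  have hℓ' : Prime (ℓ : ℤ) := Nat.prime_iff_prime_int.mp hℓ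
  have hprime : (span {(ℓ : ℤ)}).IsPrime := (span_singleton_prime hℓ'.ne_zero).mpr hℓ'
  obtain ⟨P, hP, hP'⟩ := (inferInstance : Nonempty (primesOver (span {(ℓ : ℤ)}) (𝓞 K)))
  have : (span {(ℓ : ℤ)}).IsMaximal := hprime.isMaximal (by simpa using hℓ.ne_zero)
  have : Finite (ℤ ⧸ span {(ℓ : ℤ)}) :=
    Ideal.finiteQuotientOfFreeOfNeBot _ (by simpa using hℓ.ne_zero)
  have : PerfectField (span {(ℓ : ℤ)}).ResidueField := inferInstance
  refine ⟨P, fun n => ?_, card_inertia_eq_ramificationIdxIn _ P⟩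
  rw [← mem_span_singleton, hP'.over, mem_comap]
  simp

/-! ### Squares up to units -/

/-- `x` is a square up to an integral unit. -/
def IsSqModUnits {K : Type*} [Field K] (x : K) : Prop :=
  ∃ y : K, y ≠ 0 ∧ IsIntegral ℤ (y ^ 2 / x) ∧ IsIntegral ℤ (x / y ^ 2)

namespace IsSqModUnits

variable {K : Type*} [Field K] {x y : K}

theorem of_sq_eq (hx : x ≠ 0) (h : y ^ 2 = x) : IsSqModUnits x :=
  ⟨y, by rintro rfl; simp_all, by rw [h, div_self hx]; exact isIntegral_one,
    by rw [h, div_self hx]; exact isIntegral_one⟩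

theorem of_mul (hx : x ≠ 0) (hxy : IsSqModUnits (x * y)) (h : IsSqModUnits x) :
    IsSqModUnits y := by
  obtain ⟨a, ha, ha1, ha2⟩ := hxy
  obtain ⟨b, hb, hb1, hb2⟩ := h
  refine ⟨a / b, div_ne_zero ha hb, ?_, ?_⟩
  · have : (a / b) ^ 2 / y = a ^ 2 / (x * y) * (x / b ^ 2) := by
      rcases eq_or_ne y 0 with rfl | hy
      · simp
      · field_simp
    exact this ▸ ha1.mul hb2
  · have : y / (a / b) ^ 2 = x * y / a ^ 2 * (b ^ 2 / x) := by field_simp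
    exact this ▸ ha2.mul hb1

/-- With `w² = de`, `(da + bw)² = d (da² + eb² + 2abw)`. The last factor times its conjugate is
`(da² - eb²)² = 1`, so it is a unit. -/
theorem of_pell [CharZero K] {N d e a b : ℤ} {w : K} (hw : w ^ 2 = N) (hd : 0 < d)
    (hde : d * e = N) (hab : d * a ^ 2 - e * b ^ 2 = 1) : IsSqModUnits (d : K) := by
  have hd' : (d : K) ≠ 0 := by exact_mod_cast hd.ne'
  have hwi : IsIntegral ℤ w := .of_pow two_pos (by rw [hw]; exact isIntegral_algebraMap (x := N))
  have hw' : w ^ 2 = d * e := by rw [hw, ← hde]; push_cast; ring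
  have hab' : (d : K) * a ^ 2 - e * b ^ 2 = 1 := by exact_mod_cast hab
  have hprod : (d * a ^ 2 + e * b ^ 2 + 2 * a * b * w) *
      (d * a ^ 2 + e * b ^ 2 - 2 * a * b * w) = (1 : K) := by
    linear_combination (d * a ^ 2 - e * b ^ 2 + 1 : K) * hab' - 4 * a ^ 2 * b ^ 2 * hw'
  have hi (n : ℤ) : IsIntegral ℤ (n : K) := isIntegral_algebraMap (x := n)
  have hsq : (d * a + b * w) ^ 2 = d * (d * a ^ 2 + e * b ^ 2 + 2 * a * b * w) := by
    linear_combination (b : K) ^ 2 * hw'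
  have h1 : (d * a ^ 2 + e * b ^ 2 + 2 * a * b * w : K) ≠ 0 := left_ne_zero_of_mul_eq_one hprod
  have h2 : IsIntegral ℤ (d * a ^ 2 + e * b ^ 2 : K) := by
    have := hi (d * a ^ 2 + e * b ^ 2)
    push_cast at this
    exact this
  have h3 : IsIntegral ℤ (2 * a * b * w : K) := by
    exact_mod_cast (hi (2 * a * b)).mul hwi
  refine ⟨d * a + b * w, ?_, ?_, ?_⟩
  · intro h0
    rw [h0, zero_pow two_ne_zero] at hsq
    exact mul_ne_zero hd' h1 hsq.symm
  · rw [hsq, mul_div_cancel_left₀ _ hd']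
    exact h2.add h3
  · rw [hsq, ← div_div, div_self hd', ← hprod, mul_div_cancel_left₀ _ h1]
    exact h2.sub h3

theorem exists_sq_eq_span [NumberField K] {ℓ : ℕ} (h0 : ℓ ≠ 0) (h : IsSqModUnits (ℓ : K)) :
    ∃ α : 𝓞 K, Ideal.span {α} ^ 2 = Ideal.span {(ℓ : 𝓞 K)} := by
  obtain ⟨y, hy, h1, h2⟩ := h
  have h0' : (ℓ : K) ≠ 0 := by exact_mod_cast h0
  have hyi : IsIntegral ℤ y := by
    refine .of_pow two_pos ?_
    have := h1.mul (isIntegral_algebraMap (x := (ℓ : ℤ)) : IsIntegral ℤ (algebraMap ℤ K ℓ))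
    simpa [h0'] using this
  obtain ⟨α, rfl⟩ : ∃ α : 𝓞 K, algebraMap (𝓞 K) K α = y := ⟨⟨y, hyi⟩, rfl⟩
  obtain ⟨u, hu⟩ : ∃ u : 𝓞 K, algebraMap (𝓞 K) K u = algebraMap (𝓞 K) K α ^ 2 / ℓ := ⟨⟨_, h1⟩, rfl⟩
  obtain ⟨v, hv⟩ : ∃ v : 𝓞 K, algebraMap (𝓞 K) K v = ℓ / algebraMap (𝓞 K) K α ^ 2 := ⟨⟨_, h2⟩, rfl⟩
  refine ⟨α, ?_⟩
  rw [Ideal.span_singleton_pow]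
  refine le_antisymm ?_ ?_ <;> rw [Ideal.span_singleton_le_span_singleton]
  · refine ⟨u, NumberField.RingOfIntegers.coe_injective ?_⟩
    rw [map_mul, map_pow, map_natCast, hu, mul_div_cancel₀ _ h0']
  · refine ⟨v, NumberField.RingOfIntegers.coe_injective ?_⟩
    rw [map_mul, map_pow, map_natCast, hv, mul_div_cancel₀ _ (pow_ne_zero 2 hy)]

end IsSqModUnits

/-! ### Inertia groups and square roots -/

section Galois

variable {K : Type*} [Field K] [NumberField K]

theorem isPrincipal_ostrowskiIdeal_of_inertia_eq_bot [IsGalois ℚ K] {ℓ f : ℕ} (hℓ : ℓ.Prime)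
    (h : ∀ P : Ideal (𝓞 K), (∀ n : ℤ, (n : 𝓞 K) ∈ P ↔ (ℓ : ℤ) ∣ n) →
      P.inertia Gal(K/ℚ) = ⊥) :
    (ostrowskiIdeal K (ℓ ^ f)).IsPrincipal := by
  obtain ⟨P, hn, hcard⟩ := exists_card_inertia_eq K hℓ
  rw [h P hn, Subgroup.card_bot] at hcard
  rcases ostrowskiIdeal_eq_one_or_pow_eq_span K hℓ with h1 | h1
  · rw [h1]
    exact ⟨1, by simp⟩
  · rw [← hcard, pow_one] at h1
    exact ⟨_, h1⟩

theorem isPrincipal_ostrowskiIdeal_of_inertia_ne_top [IsGalois ℚ K] {ℓ f : ℕ} (hℓ : ℓ.Prime)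
    (hGal : Nat.card Gal(K/ℚ) ≤ 4) (hsq : IsSqModUnits (ℓ : K))
    (h : ∀ P : Ideal (𝓞 K), (∀ n : ℤ, (n : 𝓞 K) ∈ P ↔ (ℓ : ℤ) ∣ n) →
      P.inertia Gal(K/ℚ) ≠ ⊤) :
    (ostrowskiIdeal K (ℓ ^ f)).IsPrincipal := by
  obtain ⟨P, hn, hcard⟩ := exists_card_inertia_eq K hℓ
  have hidx : 1 < (P.inertia Gal(K/ℚ)).index := Subgroup.one_lt_index_of_ne_top (h P hn)
  have hmul := (P.inertia Gal(K/ℚ)).card_mul_index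
  have hpos : 0 < Nat.card (P.inertia Gal(K/ℚ)) := Nat.card_pos
  have he : Nat.card (P.inertia Gal(K/ℚ)) ≤ 2 := by nlinarith
  rcases ostrowskiIdeal_eq_one_or_pow_eq_span K hℓ with h1 | h1
  · rw [h1]
    exact ⟨1, by simp⟩
  · rw [← hcard] at h1
    obtain he | he : Nat.card (P.inertia Gal(K/ℚ)) = 1 ∨ Nat.card (P.inertia Gal(K/ℚ)) = 2 := by
      omega
    · rw [he, pow_one] at h1
      exact ⟨_, h1⟩
    · rw [he] at h1
      obtain ⟨α, hα⟩ := hsq.exists_sq_eq_span hℓ.ne_zero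
      rw [← hα] at h1
      -- Both ideals have square `(ℓ)`, and unique factorization of ideals cancels the exponent.
      exact ⟨α, dvd_antisymm ((UniqueFactorizationMonoid.pow_dvd_pow_iff_dvd two_ne_zero).mp h1.dvd)
        ((UniqueFactorizationMonoid.pow_dvd_pow_iff_dvd two_ne_zero).mp h1.symm.dvd)⟩

theorem galois_apply_of_sq_eq {M : ℤ} {c : K} (hc : c ^ 2 = M) (σ : Gal(K/ℚ)) :
    σ c = c ∨ σ c = -c := by
  apply sq_eq_sq_iff_eq_or_eq_neg.mp
  rw [← map_pow, hc, map_intCast]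

/-- Inertia above `ℓ` fixes `√M` when `ℓ ∤ 2M`. -/
theorem inertia_apply_sqrt {ℓ : ℕ} {P : Ideal (𝓞 K)}
    (hn : ∀ n : ℤ, (n : 𝓞 K) ∈ P ↔ (ℓ : ℤ) ∣ n) {M : ℤ} {c : K} (hc : c ^ 2 = M)
    (hM : ¬ (ℓ : ℤ) ∣ 4 * M) {σ : Gal(K/ℚ)} (hσ : σ ∈ P.inertia Gal(K/ℚ)) : σ c = c := by
  refine (galois_apply_of_sq_eq hc σ).resolve_right fun hneg => hM ?_
  have hci : IsIntegral ℤ c := .of_pow two_pos (by rw [hc]; exact isIntegral_algebraMap (x := M))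
  obtain ⟨γ, rfl⟩ : ∃ γ : 𝓞 K, algebraMap (𝓞 K) K γ = c := ⟨⟨c, hci⟩, rfl⟩
  -- If `σ γ = -γ`, then `(σ γ - γ)² = 4M` is an integer in `P`.
  have h2 := P.mul_mem_left (σ • γ - γ) (hσ γ : σ • γ - γ ∈ P)
  rw [← hn]
  convert h2
  apply NumberField.RingOfIntegers.coe_injective
  have : algebraMap (𝓞 K) K (σ • γ) = -algebraMap (𝓞 K) K γ := hneg
  rw [map_mul, map_sub, this, map_intCast]
  push_cast
  linear_combination -4 * hc

/-- Inertia above `2` fixes `√M` when `M ≡ 1 mod 4`. -/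
theorem inertia_apply_sqrt_of_mod_four {P : Ideal (𝓞 K)}
    (hn : ∀ n : ℤ, (n : 𝓞 K) ∈ P ↔ ((2 : ℕ) : ℤ) ∣ n) {M : ℤ} {c : K} (hc : c ^ 2 = M)
    (hM : M % 4 = 1) {σ : Gal(K/ℚ)} (hσ : σ ∈ P.inertia Gal(K/ℚ)) : σ c = c := by
  refine (galois_apply_of_sq_eq hc σ).resolve_right fun hneg => ?_
  obtain ⟨k, rfl⟩ : ∃ k, M = 4 * k + 1 := ⟨M / 4, by omega⟩
  -- For `γ = (1 + c) / 2` the difference `σ γ - γ` is `-c`, whose square `M` is odd.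
  have hci : IsIntegral ℤ ((1 + c) / 2) := by
    refine ⟨Polynomial.X ^ 2 - Polynomial.X - Polynomial.C k, by monicity!, ?_⟩
    rw [Polynomial.eval₂_sub, Polynomial.eval₂_sub, Polynomial.eval₂_pow, Polynomial.eval₂_X,
      Polynomial.eval₂_C, algebraMap_int_eq, eq_intCast]
    push_cast at hc
    linear_combination hc / 4
  obtain ⟨γ, hγ⟩ : ∃ γ : 𝓞 K, algebraMap (𝓞 K) K γ = (1 + c) / 2 := ⟨⟨_, hci⟩, rfl⟩
  have h2 := P.mul_mem_left (σ • γ - γ) (hσ γ : σ • γ - γ ∈ P)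
  have h3 : ((4 * k + 1 : ℤ) : 𝓞 K) ∈ P := by
    convert h2
    apply NumberField.RingOfIntegers.coe_injective
    have : algebraMap (𝓞 K) K (σ • γ) = (1 - c) / 2 := by
      change σ (algebraMap (𝓞 K) K γ) = _
      rw [hγ, map_div₀, map_add, hneg, map_one, map_ofNat]; ring
    rw [map_mul, map_sub, this, map_intCast, hγ]
    linear_combination -hc
  rw [hn] at h3
  omega

theorem subgroup_ne_top_of_fixes_sqrt [IsGalois ℚ K] {M : ℕ} {c : K} (hc : c ^ 2 = M)
    (hM : ¬ IsSquare M) {H : Subgroup Gal(K/ℚ)} (h : ∀ σ ∈ H, σ c = c) : H ≠ ⊤ := by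
  rintro rfl
  obtain ⟨x, rfl⟩ := (IsGalois.mem_range_algebraMap_iff_fixed c).mpr fun σ => h σ trivial
  refine hM (Rat.isSquare_natCast_iff.mp ⟨x, ?_⟩)
  have : algebraMap ℚ K (x ^ 2) = algebraMap ℚ K M := by rw [map_pow, hc, map_natCast]
  rw [← (algebraMap ℚ K).injective this, pow_two]

end Galois

/-! ### Fields generated by two square roots -/

section Biquadratic

open IntermediateField

variable {K : Type*} [Field K] [NumberField K] {m n : ℕ} {a b : K}

theorem isGalois_of_adjoin_two_sqrt (ha : a ^ 2 = m) (hb : b ^ 2 = n) (h : adjoin ℚ {a, b} = ⊤) :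
    IsGalois ℚ K := by
  have key {c : K} {k : ℕ} (hc : c ^ 2 = k) :
      IsIntegral ℚ c ∧ ((minpoly ℚ c).map (algebraMap ℚ K)).Splits := by
    refine ⟨Algebra.IsIntegral.isIntegral c, ?_⟩
    have h1 : ((Polynomial.X ^ 2 - Polynomial.C (k : ℚ)).map (algebraMap ℚ K)).Splits := by
      have : (Polynomial.X ^ 2 - Polynomial.C (k : ℚ)).map (algebraMap ℚ K) =
          (Polynomial.X - Polynomial.C c) * (Polynomial.X - Polynomial.C (-c)) := by
        rw [Polynomial.map_sub, Polynomial.map_pow, Polynomial.map_X, Polynomial.map_C,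
          map_natCast (algebraMap ℚ K), ← hc, Polynomial.C_pow, Polynomial.C_neg]
        ring
      rw [this]
      exact (Polynomial.Splits.X_sub_C _).mul (Polynomial.Splits.X_sub_C _)
    refine h1.of_dvd ?_ (Polynomial.map_dvd _ (minpoly.dvd ℚ c (by simp [hc])))
    exact (Polynomial.map_ne_zero_iff (algebraMap ℚ K).injective).mpr
      (Polynomial.X_pow_sub_C_ne_zero two_pos _)
  have : Normal ℚ K := by
    refine normal_iff.mpr fun x => ⟨Algebra.IsIntegral.isIntegral x, ?_⟩
    refine splits_of_mem_adjoin ℚ K (S := {a, b}) ?_ (h ▸ mem_top)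
    rintro c (rfl | rfl)
    exacts [key ha, key hb]
  exact ⟨⟩

theorem galois_eq_one_of_fixes (h : adjoin ℚ {a, b} = ⊤) {σ : Gal(K/ℚ)} (ha : σ a = a)
    (hb : σ b = b) : σ = 1 := by
  have : adjoin ℚ {a, b} ≤ fixedField (Subgroup.zpowers σ) := by
    rw [adjoin_le_iff]
    have hfix {c : K} (hc : σ c = c) : c ∈ fixedField (Subgroup.zpowers σ) := by
      rw [mem_fixedField_iff]
      intro τ hτ
      have : Subgroup.zpowers σ ≤ MulAction.stabilizer Gal(K/ℚ) c := by
        rw [Subgroup.zpowers_le]; exact hc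
      exact this hτ
    rintro c (rfl | rfl)
    exacts [hfix ha, hfix hb]
  ext x
  have hx : x ∈ fixedField (Subgroup.zpowers σ) := this (h ▸ mem_top)
  rw [mem_fixedField_iff] at hx
  exact hx σ (Subgroup.mem_zpowers σ)

theorem card_galois_le_four (ha : a ^ 2 = m) (hb : b ^ 2 = n) (h : adjoin ℚ {a, b} = ⊤) :
    Nat.card Gal(K/ℚ) ≤ 4 := by
  classical
  let F : Gal(K/ℚ) → Bool × Bool := fun σ => (decide (σ a = a), decide (σ b = b))
  have hF : Function.Injective F := by
    intro σ τ hστ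
    simp only [F, Prod.mk.injEq, decide_eq_decide] at hστ
    have agree {c : K} {k : ℕ} (hc : c ^ 2 = k) (hiff : σ c = c ↔ τ c = c) : σ c = τ c := by
      have hc' : c ^ 2 = (k : ℤ) := by simpa using hc
      rcases galois_apply_of_sq_eq hc' σ with h1 | h1 <;>
        rcases galois_apply_of_sq_eq hc' τ with h2 | h2
      · rw [h1, h2]
      · rw [h1, hiff.mp h1]
      · rw [h2, hiff.mpr h2]
      · rw [h1, h2]
    have hone := galois_eq_one_of_fixes h (σ := τ⁻¹ * σ)
      (by rw [AlgEquiv.mul_apply, agree ha hστ.1]; exact τ.symm_apply_apply a)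
      (by rw [AlgEquiv.mul_apply, agree hb hστ.2]; exact τ.symm_apply_apply b)
    exact (inv_mul_eq_one.mp hone).symm
  calc Nat.card Gal(K/ℚ) ≤ Nat.card (Bool × Bool) := Nat.card_le_card_of_injective F hF
    _ = 4 := by simp

theorem adjoinTwoSqrt_exists_generators (m n : ℕ) : ∃ a b : adjoinTwoSqrt m n,
    a ^ 2 = m ∧ b ^ 2 = n ∧ adjoin ℚ {a, b} = ⊤ := by
  have hm : √(m : ℝ) ∈ adjoinTwoSqrt m n := subset_adjoin _ _ (by simp)
  have hn : √(n : ℝ) ∈ adjoinTwoSqrt m n := subset_adjoin _ _ (by simp)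
  refine ⟨⟨_, hm⟩, ⟨_, hn⟩, Subtype.ext ?_, Subtype.ext ?_, ?_⟩
  · simp
  · simp
  · refine eq_top_iff.mpr fun ⟨x, hx⟩ _ => ?_
    induction hx using adjoin_induction with
    | mem x hx =>
      rcases hx with rfl | rfl
      exacts [subset_adjoin _ _ (by simp), subset_adjoin _ _ (by simp)]
    | algebraMap x => exact IntermediateField.algebraMap_mem _ x
    | add x y _ _ h₁ h₂ => exact add_mem (h₁ trivial) (h₂ trivial)
    | inv x _ h => exact inv_mem (h trivial)
    | mul x y _ _ h₁ h₂ => exact mul_mem (h₁ trivial) (h₂ trivial)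

end Biquadratic

/-! ### Pell's equation and Legendre symbols -/

/-- A nonsquare `N ≡ 1, 2 mod 4` factors as `d * e` with `d ≠ 1` and `d a² - e b² = 1`. -/
theorem exists_factorization_of_pell {N : ℤ} (hN : 0 < N) (hsq : ¬ IsSquare N)
    (h4 : N % 4 = 1 ∨ N % 4 = 2) :
    ∃ d e a b : ℤ, 0 < d ∧ 0 < e ∧ d * e = N ∧ d ≠ 1 ∧ d * a ^ 2 - e * b ^ 2 = 1 := by
  obtain ⟨F, hF1, hF2, hF⟩ := Pell.IsFundamental.exists_of_not_isSquare hN hsq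
  have hprop := F.prop
  set x := F.x
  set y := F.y
  -- This is where `N % 4` matters: for `N ≡ 3`, `x` even and `y` odd would be possible.
  have hpar : y % 2 = 0 ∧ x % 2 = 1 := by
    have key : (x ^ 2 - N * y ^ 2) % 4 = 1 := by rw [hprop]; rfl
    have hx : x % 4 = 0 ∨ x % 4 = 1 ∨ x % 4 = 2 ∨ x % 4 = 3 := by omega
    have hy : y % 4 = 0 ∨ y % 4 = 1 ∨ y % 4 = 2 ∨ y % 4 = 3 := by omega
    rcases h4 with h | h <;> rcases hx with hx | hx | hx | hx <;>
      rcases hy with hy | hy | hy | hy <;>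
      simp [pow_two, Int.sub_emod, Int.mul_emod, h, hx, hy] at key <;> omega
  obtain ⟨v, hv⟩ : ∃ v, y = 2 * v := ⟨y / 2, by omega⟩
  obtain ⟨u, hu⟩ : ∃ u, x = 2 * u + 1 := ⟨x / 2, by omega⟩
  have hu0 : 0 < u := by omega
  have hv0 : 0 < v := by omega
  have huv : (u + 1) * u = N * v ^ 2 := by
    rw [hu, hv] at hprop
    linarith
  obtain ⟨m, e, hme, hm, he⟩ := Int.exists_gcd_one (m := u + 1) (n := N)
    (Int.gcd_pos_of_ne_zero_right _ hN.ne')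
  set d : ℤ := (Int.gcd (u + 1) N : ℤ) with hd
  have hd0 : 0 < d := by
    have := Int.gcd_pos_of_ne_zero_right (u + 1) hN.ne'
    omega
  have he0 : 0 < e := pos_of_mul_pos_left (by rw [← he]; exact hN) hd0.le
  have hm0 : 0 < m := pos_of_mul_pos_left (by rw [← hm]; omega) hd0.le
  have hmu : m * u = e * v ^ 2 := by
    have : d * (m * u) = d * (e * v ^ 2) := by
      calc d * (m * u) = (m * d) * u := by ring
        _ = (e * d) * v ^ 2 := by rw [← hm, ← he, huv]
        _ = _ := by ring
    exact mul_left_cancel₀ hd0.ne' this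
  obtain ⟨n, hn⟩ : e ∣ u :=
    (Int.isCoprime_iff_gcd_eq_one.mpr hme).symm.dvd_of_dvd_mul_left ⟨_, hmu⟩
  have hn0 : 0 < n := pos_of_mul_pos_right (by rw [← hn]; exact hu0) he0.le
  have hmn : m * n = v ^ 2 := by
    refine mul_left_cancel₀ he0.ne' ?_
    rw [← hmu, hn]; ring
  -- `d m - e n = (u + 1) - u = 1`.
  have hcop : IsCoprime m n := ⟨d, -e, by linear_combination hn - hm⟩
  have sq {m n : ℤ} (h : IsCoprime m n) (hmn : m * n = v ^ 2) (hm0 : 0 < m) :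
      ∃ a, m = a ^ 2 := by
    obtain ⟨a, ha | ha⟩ := Int.sq_of_isCoprime h hmn
    · exact ⟨a, ha⟩
    · nlinarith [sq_nonneg a]
  obtain ⟨a, ha⟩ := sq hcop hmn hm0
  obtain ⟨b, hb⟩ := sq hcop.symm (by rw [mul_comm, hmn]) hn0
  have hab : d * a ^ 2 - e * b ^ 2 = 1 := by
    rw [← ha, ← hb]; linear_combination hn - hm
  refine ⟨d, e, a, b, hd0, he0, by rw [he]; ring, ?_, hab⟩
  -- If `d = 1`, then `(|a|, b)` solves Pell's equation with `1 < |a| < |a|² = u + 1 < x`, against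
  -- minimality of `x`.
  intro hd1
  rw [hd1] at hm he hab
  have hab' : |a| ^ 2 - N * b ^ 2 = 1 := by rw [sq_abs, he]; linarith
  have ha2 : |a| ^ 2 = u + 1 := by rw [sq_abs]; linarith
  have h1 : 1 < |a| := by
    by_contra hcon
    have := abs_nonneg a
    nlinarith
  have := hF (b := Pell.Solution₁.mk |a| b hab') (by simpa using h1)
  simp only [Pell.Solution₁.x_mk] at this
  change x ≤ |a| at this
  nlinarith

theorem legendreSym_neg_of_mod_four {ℓ : ℕ} [Fact ℓ.Prime] (h3 : ℓ % 4 = 3) (a : ℤ) :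
    legendreSym ℓ (-a) = -legendreSym ℓ a := by
  rw [legendreSym.at_neg (by rintro rfl; omega), ZMod.χ₄_nat_three_mod_four h3, neg_one_mul]

theorem legendreSym_eq_one_of_dvd {ℓ : ℕ} [Fact ℓ.Prime] {d a : ℤ}
    (h : (ℓ : ℤ) ∣ d * a ^ 2 - 1) : legendreSym ℓ d = 1 := by
  have h0 : (d : ZMod ℓ) * (a : ZMod ℓ) ^ 2 = 1 := by
    have := (ZMod.intCast_zmod_eq_zero_iff_dvd _ ℓ).mpr h
    push_cast at this
    exact sub_eq_zero.mp this
  have ha : (a : ZMod ℓ) ≠ 0 := by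
    intro ha
    simp [ha] at h0
  have hd : (d : ZMod ℓ) ≠ 0 := by
    intro hd
    simp [hd] at h0
  rw [legendreSym.eq_one_iff ℓ hd]
  exact ⟨(a : ZMod ℓ)⁻¹, by field_simp; linear_combination h0⟩

theorem exists_factor_of_mul_eq_prime_mul {ℓ d e M : ℤ} (hℓ : Prime ℓ) (hℓ0 : 0 < ℓ)
    (h : d * e = ℓ * M) (hd : 0 < d) :
    ∃ d' e', d' * e' = M ∧ 0 < d' ∧ ((d = ℓ * d' ∧ e = e') ∨ (d = d' ∧ e = ℓ * e')) := by
  rcases hℓ.dvd_or_dvd (Dvd.intro M h.symm) with ⟨k, rfl⟩ | ⟨k, rfl⟩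
  · exact ⟨k, e, mul_left_cancel₀ hℓ.ne_zero (by rw [← h]; ring),
      pos_of_mul_pos_right hd hℓ0.le, .inl ⟨rfl, rfl⟩⟩
  · exact ⟨d, k, mul_left_cancel₀ hℓ.ne_zero (by rw [← h]; ring), hd, .inr ⟨rfl, rfl⟩⟩

/-- If `D a² - E b² = 1`, a prime `ℓ ≡ 3 mod 4` dividing `D * E` divides one of the two
factors, and that determines the Legendre symbol at `ℓ` of the other one. -/
theorem exists_factor_and_legendreSym {ℓ : ℕ} [Fact ℓ.Prime] (h3 : ℓ % 4 = 3)
    {D E a b d e M : ℤ} (hab : D * a ^ 2 - E * b ^ 2 = 1) (hdD : d ∣ D) (heE : e ∣ E)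
    (h : d * e = ℓ * M) (hd : 0 < d) :
    ∃ d' e', d' * e' = M ∧ 0 < d' ∧ d' ∣ D ∧ e' ∣ E ∧
      ((d = ℓ * d' ∧ e = e' ∧ legendreSym ℓ E = -1) ∨
        (d = d' ∧ e = ℓ * e' ∧ legendreSym ℓ D = 1)) := by
  obtain ⟨d', e', h', hd', ⟨rfl, rfl⟩ | ⟨rfl, rfl⟩⟩ := exists_factor_of_mul_eq_prime_mul
    (Nat.prime_iff_prime_int.mp Fact.out) (by exact_mod_cast (Fact.out : ℓ.Prime).pos) h hd
  · refine ⟨d', e, h', hd', dvd_of_mul_left_dvd hdD, heE, .inl ⟨rfl, rfl, ?_⟩⟩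
    obtain ⟨k, hk⟩ := dvd_of_mul_right_dvd hdD
    -- Modulo `ℓ ∣ D` the equation reads `-E b² = 1`, and `-1` is a nonresidue.
    have : legendreSym ℓ (-E) = 1 := legendreSym_eq_one_of_dvd (a := b)
      ⟨-(k * a ^ 2), by rw [hk] at hab; linear_combination hab⟩
    rw [legendreSym_neg_of_mod_four h3] at this
    omega
  · refine ⟨d, e', h', hd', hdD, dvd_of_mul_left_dvd heE, .inr ⟨rfl, rfl, ?_⟩⟩
    obtain ⟨k, hk⟩ := dvd_of_mul_right_dvd heE
    exact legendreSym_eq_one_of_dvd (a := a)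
      ⟨k * b ^ 2, by rw [hk] at hab; linear_combination hab⟩

theorem legendreSym_swap_of_mod_four {ℓ k : ℕ} [Fact ℓ.Prime] [Fact k.Prime] (hℓ : ℓ % 4 = 3)
    (hk : k % 4 = 3) : legendreSym ℓ k = -legendreSym k ℓ := by
  rw [legendreSym.quadratic_reciprocity_three_mod_four hℓ hk]; ring

theorem legendreSym_natCast_eq_one_or_neg_one {ℓ k : ℕ} [Fact ℓ.Prime] [Fact k.Prime]
    (h : ℓ ≠ k) : legendreSym ℓ k = 1 ∨ legendreSym ℓ k = -1 := by
  apply legendreSym.eq_one_or_neg_one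
  rw [Int.cast_natCast, Ne, ZMod.natCast_eq_zero_iff]
  exact fun h' => h ((Nat.prime_dvd_prime_iff_eq Fact.out Fact.out).mp h')

theorem legendreSym_two_eq_one_or_neg_one {ℓ : ℕ} [Fact ℓ.Prime] (h : ℓ ≠ 2) :
    legendreSym ℓ 2 = 1 ∨ legendreSym ℓ 2 = -1 := by
  have : Fact (Nat.Prime 2) := ⟨Nat.prime_two⟩
  simpa using legendreSym_natCast_eq_one_or_neg_one h

theorem not_isSquare_of_mod_four {N : ℤ} (h : N % 4 = 2) : ¬ IsSquare N := by
  rintro ⟨x, rfl⟩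
  have hx : x % 4 = 0 ∨ x % 4 = 1 ∨ x % 4 = 2 ∨ x % 4 = 3 := by omega
  rcases hx with hx | hx | hx | hx <;> simp [Int.mul_emod, hx] at h

theorem not_isSquare_mul_prime {M ℓ : ℕ} (hℓ : ℓ.Prime) (h : ¬ ℓ ∣ M) : ¬ IsSquare (M * ℓ) := by
  rintro ⟨x, hx⟩
  obtain ⟨k, rfl⟩ : ℓ ∣ x := by
    have : ℓ ∣ x * x := ⟨M, by rw [← hx, mul_comm]⟩
    exact (hℓ.dvd_mul.mp this).elim id id
  exact h ⟨k * k, Nat.eq_of_mul_eq_mul_right hℓ.pos (by rw [hx]; ring)⟩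

/-- The remaining case `d = 2p`, `e = 1` would need `legendreSym p 1 = -1`. -/
theorem two_mul_sq_sub_of_prime {p : ℕ} [Fact p.Prime] (hp : p % 4 = 3) :
    ∃ d e a b : ℤ, 0 < d ∧ 0 < e ∧ d * e = 2 * p ∧ d * a ^ 2 - e * b ^ 2 = 1 ∧
      (d = 2 ∨ d = p) := by
  obtain ⟨d, e, a, b, hd, he, hde, hd1, hab⟩ := exists_factorization_of_pell (N := 2 * p)
    (by have := (Fact.out : p.Prime).pos; omega) (not_isSquare_of_mod_four (by omega)) (by omega)
  refine ⟨d, e, a, b, hd, he, hde, hab, ?_⟩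
  obtain ⟨d₁, e₁, h₁, hd₁, -, -, hp'⟩ := exists_factor_and_legendreSym hp hab dvd_rfl dvd_rfl
    (show d * e = p * (2 * 1) by rw [hde]; ring) hd
  obtain ⟨d₂, e₂, h₂, hd₂, h2'⟩ := exists_factor_of_mul_eq_prime_mul Int.prime_two two_pos h₁ hd₁
  obtain rfl := Int.eq_one_of_mul_eq_one_right hd₂.le h₂
  obtain rfl : e₂ = 1 := by omega
  rcases hp' with ⟨rfl, rfl, hlp⟩ | ⟨rfl, rfl, hlp⟩ <;>
  rcases h2' with ⟨rfl, rfl⟩ | ⟨rfl, rfl⟩ <;> simp at hlp hd1 ⊢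

/-- The symbols leave `d = 2r` if `legendreSym r 2 = t`, and `d = 2s` if it is `-t`. -/
theorem two_mul_three_primes_sq_sub {q r s : ℕ} [Fact q.Prime] [Fact r.Prime] [Fact s.Prime]
    (hq : q % 4 = 3) (hr : r % 4 = 3) (hs : s % 4 = 3) {t : ℤ} (ht : t = 1 ∨ t = -1)
    (hqr : legendreSym r q = t) (hrs : legendreSym s r = t) (hsq : legendreSym q s = t)
    (h2rs : legendreSym r 2 = legendreSym s 2) (h2sq : legendreSym s 2 ≠ legendreSym q 2) :
    ∃ d e a b : ℤ, 0 < d ∧ 0 < e ∧ d * e = 2 * q * r * s ∧ d * a ^ 2 - e * b ^ 2 = 1 ∧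
      (d = 2 * s ∨ d = 2 * r) := by
  have hrq : legendreSym q r = -t := by rw [legendreSym_swap_of_mod_four hq hr, hqr]
  have hsr : legendreSym r s = -t := by rw [legendreSym_swap_of_mod_four hr hs, hrs]
  have hqs : legendreSym s q = -t := by rw [legendreSym_swap_of_mod_four hs hq, hsq]
  have h2r := legendreSym_two_eq_one_or_neg_one (ℓ := r) (by rintro rfl; omega)
  have h2q := legendreSym_two_eq_one_or_neg_one (ℓ := q) (by rintro rfl; omega)
  have h2q' : legendreSym q 2 = - legendreSym r 2 := by omega
  have hmod : (2 * q * r * s : ℤ) % 4 = 2 := by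
    have h1 : (q : ℤ) % 4 = 3 := by omega
    have h2 : (r : ℤ) % 4 = 3 := by omega
    have h3 : (s : ℤ) % 4 = 3 := by omega
    simp [Int.mul_emod, h1, h2, h3]
  obtain ⟨d, e, a, b, hd, he, hde, hd1, hab⟩ := exists_factorization_of_pell (N := 2 * q * r * s)
    (by
      have := (Fact.out : q.Prime).pos
      have := (Fact.out : r.Prime).pos
      have := (Fact.out : s.Prime).pos
      positivity) (not_isSquare_of_mod_four hmod) (.inr hmod)
  refine ⟨d, e, a, b, hd, he, hde, hab, ?_⟩
  -- The primes are split off one by one: `dᵢ`, `eᵢ` are the remaining cofactors, while each symbol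
  -- condition concerns the full `d` or `e`.
  obtain ⟨d₁, e₁, h₁, hd₁, hD₁, hE₁, hq'⟩ := exists_factor_and_legendreSym hq hab dvd_rfl dvd_rfl
    (show d * e = q * (r * (s * (2 * 1))) by rw [hde]; ring) hd
  obtain ⟨d₂, e₂, h₂, hd₂, hD₂, hE₂, hr'⟩ := exists_factor_and_legendreSym hr hab hD₁ hE₁ h₁ hd₁
  obtain ⟨d₃, e₃, h₃, hd₃, -, -, hs'⟩ := exists_factor_and_legendreSym hs hab hD₂ hE₂ h₂ hd₂
  obtain ⟨d₄, e₄, h₄, hd₄, h2'⟩ := exists_factor_of_mul_eq_prime_mul Int.prime_two two_pos h₃ hd₃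
  obtain rfl := Int.eq_one_of_mul_eq_one_right hd₄.le h₄
  obtain rfl : e₄ = 1 := by omega
  clear h₁ h₂ h₃ h₄ hd₁ hd₂ hd₃ hd₄ hD₁ hE₁ hD₂ hE₂ hde hab hd he hmod
  rcases hq' with ⟨rfl, rfl, hlq⟩ | ⟨rfl, rfl, hlq⟩ <;>
  rcases hr' with ⟨rfl, rfl, hlr⟩ | ⟨rfl, rfl, hlr⟩ <;>
  rcases hs' with ⟨rfl, rfl, hls⟩ | ⟨rfl, rfl, hls⟩ <;>
  rcases h2' with ⟨rfl, rfl⟩ | ⟨rfl, rfl⟩ <;>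
  simp only [legendreSym.mul, hqr, hrs, hsq, hrq, hsr, hqs, h2q', ← h2rs,
    legendreSym.at_one] at hlq hlr hls hd1 ⊢ <;>
  generalize legendreSym r 2 = c at * <;>
  rcases ht with rfl | rfl <;> rcases h2r with rfl | rfl <;> simp [mul_comm] at hlq hlr hls hd1 ⊢

/-- `legendreSym q p` is not determined by the hypotheses; both of its values lead to `d = pq`. -/
theorem four_primes_sq_sub {p q r s : ℕ} [Fact p.Prime] [Fact q.Prime] [Fact r.Prime]
    [Fact s.Prime] (hp : p % 4 = 3) (hq : q % 4 = 3) (hr : r % 4 = 3) (hs : s % 4 = 3)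
    (hpq : p ≠ q) {t : ℤ} (ht : t = 1 ∨ t = -1)
    (hqr : legendreSym r q = t) (hrs : legendreSym s r = t) (hsq : legendreSym q s = t)
    (hpr : legendreSym r p = t) (hps : legendreSym s p = -t)
    (hN : ¬ IsSquare (p * q * r * s)) :
    ∃ d e a b : ℤ, 0 < d ∧ 0 < e ∧ d * e = p * q * r * s ∧ d * a ^ 2 - e * b ^ 2 = 1 ∧
      d = p * q := by
  have hrq : legendreSym q r = -t := by rw [legendreSym_swap_of_mod_four hq hr, hqr]
  have hsr : legendreSym r s = -t := by rw [legendreSym_swap_of_mod_four hr hs, hrs]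
  have hqs : legendreSym s q = -t := by rw [legendreSym_swap_of_mod_four hs hq, hsq]
  have hrp : legendreSym p r = -t := by rw [legendreSym_swap_of_mod_four hp hr, hpr]
  have hsp : legendreSym p s = t := by rw [legendreSym_swap_of_mod_four hp hs, hps, neg_neg]
  have hqp := legendreSym_swap_of_mod_four hp hq
  have hu := legendreSym_natCast_eq_one_or_neg_one (ℓ := q) (k := p) hpq.symm
  have hmod : (p * q * r * s : ℤ) % 4 = 1 := by
    have h0 : (p : ℤ) % 4 = 3 := by omega
    have h1 : (q : ℤ) % 4 = 3 := by omega
    have h2 : (r : ℤ) % 4 = 3 := by omega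
    have h3 : (s : ℤ) % 4 = 3 := by omega
    simp [Int.mul_emod, h0, h1, h2, h3]
  obtain ⟨d, e, a, b, hd, he, hde, hd1, hab⟩ := exists_factorization_of_pell (N := p * q * r * s)
    (by
      have := (Fact.out : p.Prime).pos
      have := (Fact.out : q.Prime).pos
      have := (Fact.out : r.Prime).pos
      have := (Fact.out : s.Prime).pos
      positivity) (by rw [← Int.isSquare_natCast_iff] at hN; simpa using hN) (.inl hmod)
  refine ⟨d, e, a, b, hd, he, hde, hab, ?_⟩
  obtain ⟨d₁, e₁, h₁, hd₁, hD₁, hE₁, hq'⟩ := exists_factor_and_legendreSym hq hab dvd_rfl dvd_rfl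
    (show d * e = q * (r * (s * (p * 1))) by rw [hde]; ring) hd
  obtain ⟨d₂, e₂, h₂, hd₂, hD₂, hE₂, hr'⟩ := exists_factor_and_legendreSym hr hab hD₁ hE₁ h₁ hd₁
  obtain ⟨d₃, e₃, h₃, hd₃, hD₃, hE₃, hs'⟩ := exists_factor_and_legendreSym hs hab hD₂ hE₂ h₂ hd₂
  obtain ⟨d₄, e₄, h₄, hd₄, -, -, hp'⟩ := exists_factor_and_legendreSym hp hab hD₃ hE₃ h₃ hd₃
  obtain rfl := Int.eq_one_of_mul_eq_one_right hd₄.le h₄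
  obtain rfl : e₄ = 1 := by omega
  clear h₁ h₂ h₃ h₄ hd₁ hd₂ hd₃ hd₄ hD₁ hE₁ hD₂ hE₂ hD₃ hE₃ hde hab hd he hmod
  rcases hq' with ⟨rfl, rfl, hlq⟩ | ⟨rfl, rfl, hlq⟩ <;>
  rcases hr' with ⟨rfl, rfl, hlr⟩ | ⟨rfl, rfl, hlr⟩ <;>
  rcases hs' with ⟨rfl, rfl, hls⟩ | ⟨rfl, rfl, hls⟩ <;>
  rcases hp' with ⟨rfl, rfl, hlp⟩ | ⟨rfl, rfl, hlp⟩ <;>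
  simp only [legendreSym.mul, hqr, hrs, hsq, hrq, hsr, hqs, hpr, hps, hrp, hsp, hqp,
    legendreSym.at_one] at hlp hlq hlr hls hd1 ⊢ <;>
  generalize legendreSym q p = c at * <;>
  rcases ht with rfl | rfl <;> rcases hu with rfl | rfl <;>
  simp [mul_comm] at hlp hlq hlr hls hd1 ⊢

/-! ### The five primes and the Pólya property -/

theorem isSqModUnits_primes {K : Type*} [Field K] [CharZero K] {p q r s : ℕ} [Fact p.Prime]
    [Fact q.Prime] [Fact r.Prime] [Fact s.Prime]
    (hp : p % 4 = 3) (hq : q % 4 = 3) (hr : r % 4 = 3) (hs : s % 4 = 3)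
    {t : ℤ} (ht : t = 1 ∨ t = -1)
    (hqr : legendreSym r q = t) (hrs : legendreSym s r = t) (hsq : legendreSym q s = t)
    (hpr : legendreSym r p = t) (hps : legendreSym s p = -t)
    (h2rs : legendreSym r 2 = legendreSym s 2) (h2sq : legendreSym s 2 ≠ legendreSym q 2)
    (hN : ¬ IsSquare (p * q * r * s)) {a b c : K} (ha : a ^ 2 = 2 * p)
    (hb : b ^ 2 = 2 * q * r * s) (hc : c ^ 2 = p * q * r * s) :
    IsSqModUnits (2 : K) ∧ IsSqModUnits (p : K) ∧ IsSqModUnits (q : K) ∧ IsSqModUnits (r : K) ∧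
      IsSqModUnits (s : K) := by
  have h0 (k : ℕ) [Fact k.Prime] : (k : K) ≠ 0 := by exact_mod_cast (Fact.out : k.Prime).ne_zero
  have hp0 := h0 p
  have hq0 := h0 q
  have hr0 := h0 r
  have hs0 := h0 s
  have h20 : (2 : K) ≠ 0 := two_ne_zero
  have h2p : IsSqModUnits (2 * p : K) := .of_sq_eq (by positivity) ha
  have h2qrs : IsSqModUnits (2 * (q * (r * s)) : K) :=
    .of_sq_eq (by simp [*]) (by rw [hb]; ring)
  obtain ⟨h2, hpK⟩ : IsSqModUnits (2 : K) ∧ IsSqModUnits (p : K) := by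
    obtain ⟨d, e, x, y, hd, he, hde, hxy, h⟩ := two_mul_sq_sub_of_prime hp
    have := IsSqModUnits.of_pell (w := a) (by rw [ha]; push_cast; rfl) hd hde hxy
    rcases h with rfl | rfl
    · have h2 : IsSqModUnits (2 : K) := by exact_mod_cast this
      exact ⟨h2, h2p.of_mul h20 h2⟩
    · have hpK : IsSqModUnits (p : K) := by exact_mod_cast this
      rw [mul_comm] at h2p
      exact ⟨h2p.of_mul hp0 hpK, hpK⟩
  have hqrsK := h2qrs.of_mul h20 h2
  have hqK : IsSqModUnits (q : K) := by
    -- The symbol conditions do not exclude `p = q`.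
    by_cases hpq : p = q
    · exact hpq ▸ hpK
    · obtain ⟨d, e, x, y, hd, he, hde, hxy, rfl⟩ :=
        four_primes_sq_sub hp hq hr hs hpq ht hqr hrs hsq hpr hps hN
      have := IsSqModUnits.of_pell (w := c) (by rw [hc]; push_cast; rfl) hd hde hxy
      exact IsSqModUnits.of_mul hp0 (by exact_mod_cast this) hpK
  have hrsK := hqrsK.of_mul hq0 hqK
  refine ⟨h2, hpK, hqK, ?_⟩
  obtain ⟨d, e, x, y, hd, he, hde, hxy, h⟩ :=
    two_mul_three_primes_sq_sub hq hr hs ht hqr hrs hsq h2rs h2sq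
  have := IsSqModUnits.of_pell (w := b) (by rw [hb]; push_cast; rfl) hd hde hxy
  rcases h with rfl | rfl
  · have hsK : IsSqModUnits (s : K) := .of_mul h20 (by exact_mod_cast this) h2
    rw [mul_comm] at hrsK
    exact ⟨hrsK.of_mul hs0 hsK, hsK⟩
  · have hrK : IsSqModUnits (r : K) := .of_mul h20 (by exact_mod_cast this) h2
    exact ⟨hrK, hrsK.of_mul hr0 hrK⟩

theorem prime_dvd_two_mul_prime {ℓ p : ℕ} (hℓ : ℓ.Prime) (hp : p.Prime)
    (h : (ℓ : ℤ) ∣ 4 * (2 * p : ℕ)) : ℓ = 2 ∨ ℓ = p := by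
  have h' : ℓ ∣ 4 * (2 * p) := by exact_mod_cast h
  rw [show 4 * (2 * p) = 2 ^ 3 * p by ring, hℓ.dvd_mul] at h'
  exact h'.imp (fun h => (Nat.prime_dvd_prime_iff_eq hℓ Nat.prime_two).mp (hℓ.dvd_of_dvd_pow h))
    (Nat.prime_dvd_prime_iff_eq hℓ hp).mp

theorem prime_dvd_two_mul_three_primes {ℓ q r s : ℕ} (hℓ : ℓ.Prime) (hq : q.Prime) (hr : r.Prime)
    (hs : s.Prime) (h : (ℓ : ℤ) ∣ 4 * (2 * q * r * s : ℕ)) : ℓ = 2 ∨ ℓ = q ∨ ℓ = r ∨ ℓ = s := by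
  have h' : ℓ ∣ 4 * (2 * q * r * s) := by exact_mod_cast h
  rw [show 4 * (2 * q * r * s) = 2 ^ 3 * (q * (r * s)) by ring, hℓ.dvd_mul, hℓ.dvd_mul,
    hℓ.dvd_mul] at h'
  exact h'.imp (fun h => (Nat.prime_dvd_prime_iff_eq hℓ Nat.prime_two).mp (hℓ.dvd_of_dvd_pow h))
    (Or.imp (Nat.prime_dvd_prime_iff_eq hℓ hq).mp
      (Or.imp (Nat.prime_dvd_prime_iff_eq hℓ hr).mp (Nat.prime_dvd_prime_iff_eq hℓ hs).mp))

theorem isPolyaField_of_isSqModUnits_primes {K : Type*} [Field K] [NumberField K] {p q r s : ℕ}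
    [Fact p.Prime] [Fact q.Prime] [Fact r.Prime] [Fact s.Prime]
    (hp : p % 4 = 3) (hq : q % 4 = 3) (hr : r % 4 = 3) (hs : s % 4 = 3)
    (hrp : r ≠ p) (hsp : s ≠ p) (hsq : s ≠ q) (hsr : s ≠ r)
    {a b : K} (ha : a ^ 2 = (2 * p : ℕ)) (hb : b ^ 2 = (2 * q * r * s : ℕ))
    (hab : IntermediateField.adjoin ℚ {a, b} = ⊤)
    (hsqmod : IsSqModUnits (2 : K) ∧ IsSqModUnits (p : K) ∧ IsSqModUnits (q : K) ∧
      IsSqModUnits (r : K) ∧ IsSqModUnits (s : K)) : IsPolyaField K := by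
  have := isGalois_of_adjoin_two_sqrt ha hb hab
  have hGal := card_galois_le_four ha hb hab
  have hpP : p.Prime := Fact.out
  have hqP : q.Prime := Fact.out
  have hrP : r.Prime := Fact.out
  have hsP : s.Prime := Fact.out
  have ha' : a ^ 2 = ((2 * p : ℕ) : ℤ) := by rw [ha]; push_cast; rfl
  have hb' : b ^ 2 = ((2 * q * r * s : ℕ) : ℤ) := by rw [hb]; push_cast; rfl
  have hc : (a * b / 2) ^ 2 = (p * q * r * s : ℕ) := by
    rw [div_pow, mul_pow, ha, hb]; push_cast; ring
  have hc' : (a * b / 2) ^ 2 = ((p * q * r * s : ℕ) : ℤ) := by rw [hc]; push_cast; rfl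
  have hcsq : ¬ IsSquare (p * q * r * s) := by
    refine not_isSquare_mul_prime hsP ?_
    simp only [hsP.dvd_mul, Nat.prime_dvd_prime_iff_eq hsP, hpP, hqP, hrP]
    tauto
  have hasq : ¬ IsSquare (2 * p) := by
    rw [← Int.isSquare_natCast_iff]
    exact not_isSquare_of_mod_four (by omega)
  have hmod : (2 * q * r * s) % 4 = 2 ∧ (p * q * r * s) % 4 = 1 := by
    simp [Nat.mul_mod, hp, hq, hr, hs]
  have hbsq : ¬ IsSquare (2 * q * r * s) := by
    rw [← Int.isSquare_natCast_iff]
    exact not_isSquare_of_mod_four (by omega)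
  intro ℓ f hℓ _
  have of_sqrt (hsqℓ : IsSqModUnits (ℓ : K)) {M : ℕ} {c : K} (hc : c ^ 2 = M) (hM : ¬ IsSquare M)
      (hℓM : ¬ (ℓ : ℤ) ∣ 4 * M) : (ostrowskiIdeal K (ℓ ^ f)).IsPrincipal :=
    isPrincipal_ostrowskiIdeal_of_inertia_ne_top hℓ hGal hsqℓ fun P hn =>
      subgroup_ne_top_of_fixes_sqrt hc hM fun σ hσ =>
        inertia_apply_sqrt hn (M := M) (by rw [hc]; push_cast; rfl) hℓM hσ
  by_cases h2 : ℓ = 2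
  · subst h2
    -- Above 2 the fixed root is `ab/2 = √(pqrs)`, as `pqrs ≡ 1 mod 4`.
    exact isPrincipal_ostrowskiIdeal_of_inertia_ne_top hℓ hGal (by exact_mod_cast hsqmod.1)
      fun P hn => subgroup_ne_top_of_fixes_sqrt hc hcsq fun σ hσ =>
        inertia_apply_sqrt_of_mod_four hn hc' (by exact_mod_cast hmod.2) hσ
  by_cases h : ℓ = p
  · subst h
    by_cases hℓq : ℓ = q
    · subst hℓq
      -- Here `p = q = ℓ` divides both radicands, but `ab/(2ℓ)` is a square root of `rs`.
      refine of_sqrt hsqmod.2.1 (M := r * s) (c := a * b / (2 * ℓ)) ?_ ?_ ?_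
      · have : (ℓ : K) ≠ 0 := by exact_mod_cast hℓ.ne_zero
        rw [div_pow, mul_pow, ha, hb]; push_cast; field_simp
      · intro h
        refine hcsq ?_
        rw [mul_assoc]
        exact (IsSquare.mul_self ℓ).mul h
      · intro h
        rcases prime_dvd_two_mul_three_primes (q := 2) hℓ Nat.prime_two hrP hsP
          (h.trans ⟨4, by push_cast; ring⟩) with h | h | h | h
        · exact h2 h
        · exact h2 h
        · exact hrp h.symm
        · exact hsp h.symm
    · refine of_sqrt hsqmod.2.1 hb hbsq fun h => ?_
      rcases prime_dvd_two_mul_three_primes hℓ hqP hrP hsP h with h | h | h | h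
      exacts [h2 h, hℓq h, hrp h.symm, hsp h.symm]
  by_cases hram : ℓ = q ∨ ℓ = r ∨ ℓ = s
  · refine of_sqrt ?_ ha hasq fun h' => (prime_dvd_two_mul_prime hℓ hpP h').elim h2 h
    rcases hram with rfl | rfl | rfl
    exacts [hsqmod.2.2.1, hsqmod.2.2.2.1, hsqmod.2.2.2.2]
  · refine isPrincipal_ostrowskiIdeal_of_inertia_eq_bot hℓ fun P hn => ?_
    refine (Subgroup.eq_bot_iff_forall _).mpr fun σ hσ => ?_
    exact galois_eq_one_of_fixes hab
      (inertia_apply_sqrt hn ha'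
        (fun h' => (prime_dvd_two_mul_prime hℓ hpP h').elim h2 h) hσ)
      (inertia_apply_sqrt hn hb'
        (fun h' => (prime_dvd_two_mul_three_primes hℓ hqP hrP hsP h').elim h2 hram) hσ)

theorem theorem1p6 (p q r s : ℕ) [Fact p.Prime] [Fact q.Prime] [Fact r.Prime] [Fact s.Prime]
    (hp : p % 4 = 3) (hq : q % 4 = 3) (hr : r % 4 = 3) (hs : s % 4 = 3)
    (h2rs : legendreSym r 2 = legendreSym s 2) (h2sq : legendreSym s 2 ≠ legendreSym q 2)
    (hqr : legendreSym r q = legendreSym s r) (hrs : legendreSym s r = legendreSym q s)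
    (hpr : legendreSym s (p * r) = -1) (hps : legendreSym r (p * s) = -1) :
    IsPolyaField (adjoinTwoSqrt (2 * p) (2 * q * r * s)) := by
  have self (k : ℕ) [Fact k.Prime] : legendreSym k k = 0 :=
    (legendreSym.eq_zero_iff k k).mpr (by simp)
  rw [legendreSym.mul] at hpr hps
  have hsr : s ≠ r := by
    rintro rfl
    simp [self] at hpr
  have hsp : s ≠ p := by
    rintro rfl
    simp [self] at hpr
  have hrp : r ≠ p := by
    rintro rfl
    simp [self] at hps
  have ht := legendreSym_natCast_eq_one_or_neg_one hsr
  have hsq : s ≠ q := by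
    rintro rfl
    rw [self] at hrs
    omega
  -- With `t = legendreSym s r = ±1`, reciprocity turns the two product conditions into `legendreSym
  -- r p = t` and `legendreSym s p = -t`.
  rw [legendreSym_swap_of_mod_four hr hs] at hps
  have hpr' : legendreSym r p = legendreSym s r := by
    rcases ht with h | h <;> rw [h] at hps ⊢ <;> linarith
  have hps' : legendreSym s p = -legendreSym s r := by
    rcases ht with h | h <;> rw [h] at hpr ⊢ <;> linarith
  obtain ⟨a, b, ha, hb, hab⟩ := adjoinTwoSqrt_exists_generators (2 * p) (2 * q * r * s)
  refine isPolyaField_of_isSqModUnits_primes hp hq hr hs hrp hsp hsq hsr ha hb hab ?_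
  refine isSqModUnits_primes hp hq hr hs ht hqr rfl hrs.symm hpr' hps' h2rs h2sq ?_
    (a := a) (b := b) (c := a * b / 2) (by rw [ha]; push_cast; rfl) (by rw [hb]; push_cast; rfl)
    (by rw [div_pow, mul_pow, ha, hb]; push_cast; ring)
  refine not_isSquare_mul_prime Fact.out ?_
  have hP (k : ℕ) [Fact k.Prime] : k.Prime := Fact.out
  simp only [(hP s).dvd_mul, Nat.prime_dvd_prime_iff_eq (hP s), hP p, hP q, hP r]
  tauto
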